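/- **Theorem 4.1 (composition law for aromatic S-series).** Let $\mathbb{k}$ be $\mathbb{R}$ or $\mathbb{C}$. A directed graph $(V,E)$ has a finite (possibly empty) vertex set $V$ and edge set $E\subseteq V\times V$ (self-loops allowed). Let $\mathcal{AF}$ be the set of aromatic forests, i.e. of isomorphism classes of directed graphs in which every vertex has at most one outgoing edge. For $\phi\in\mathcal{AF}$ let $|\phi|$ be its number of vertices, $\sigma(\phi)$ the order of its automorphism group, $r(\phi)$ its set of roots (vertices without outgoing edge), and $\pi(p)=\{q:(q,p)\in E\}$ the set of direct predecessors of a vertex $p$. Let $C_{\mathcal{AF}}$ be the free $\mathbb{k}$-vector space on $\mathcal{AF}$. An admissible partition $p$ of $\phi$ is a partition of its vertex set into two (possibly empty) sets spanning the induced subgraphs $P^*(p)$ and $R(p)$, such that no edge of $\phi$ goes from $R(p)$ to $P^*(p)$. Let $\Delta_{\mathcal{AF}}:C_{\mathcal{AF}}\to C_{\mathcal{AF}}\otimes C_{\mathcal{AF}}$ be the linear map with $\Delta_{\mathcal{AF}}(\phi)=\sum_p P^*(p)\otimes R(p)$, the sum over all admissible partitions $p$ of $\phi$. Let $\mathbb{K}$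 be $\mathbb{R}$ or $\mathbb{C}$, let $f:\mathbb{K}^n\to\mathbb{K}^n$ be smooth (over $\mathbb{K}$), and let $W$ be a normed space over both $\mathbb{K}$ and $\mathbb{k}$ on which the two scalar multiplications commute (for example $W=\mathbb{K}=\mathbb{k}=\mathbb{R}$). For $\phi=(V,E)$ and smooth $G:\mathbb{K}^n\to W$ put $$F_f(\phi)[G]=\sum_{i:V\to\{1,\dots,n\}}\ \Big(\prod_{p\in V}\Big(\prod_{q\in\pi(p)}\frac{\partial}{\partial x_{i_q}}\Big)f^{i_p}\Big)\Big(\prod_{s\in r(\phi)}\frac{\partial}{\partial x_{i_s}}\Big)G .$$ For linear $a:C_{\mathcal{AF}}\to\mathbb{k}$, the aromatic S-series is the formal series $S_f(a)[G]=\sum_{\phi\in\mathcal{AF}}h^{|\phi|}\frac{a(\phi)}{\sigma(\phi)}F_f(\phi)[G]$, graded by the number of vertices through the formal variable $h$, and $S_f(a)$ is extended to formal power series $G=\sum_{m\ge 0}h^mG_m$ with smooth coefficients $G_m:\mathbb{K}^n\to W$ by linearity over $h$. Let $a,b:C_{\mathcal{AF}}\to\mathbb{k}$ be linear and define $b\cdot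 a=(b\otimes a)\circ\Delta_{\mathcal{AF}}:C_{\mathcal{AF}}\to\mathbb{k}$. Then for every $\phi\in\mathcal{AF}$ $$(b\cdot a)(\phi)=\sum_{p}b(P^*(p))\,a(R(p)),$$ the sum over all admissible partitions $p$ of $\phi$, and for all $f$ and $W$ as above $$S_f(b)\big[S_f(a)[G]\big]=S_f(b\cdot a)[G]$$ for every formal power series $G$ in $h$ with smooth coefficients, in particular for every smooth function $G:\mathbb{K}^n\to W$. -/

import Mathlib

open scoped ContDiff TensorProduct

noncomputable section

namespace Aromatic

/-! ### Directed graphs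

A directed graph on a finite vertex set `V` is Mathlib's `Digraph V` (an edge set `E ⊆ V × V`,
self-loops allowed).  Equivalences of graphs are relation isomorphisms `D.Adj ≃r D'.Adj`. -/

section Graphs

variable {V : Type*}

/-- Every vertex has at most one outgoing edge. -/
def IsAromatic (D : Digraph V) : Prop :=
  ∀ u v w, D.Adj u v → D.Adj u w → v = w

/-- The subgraph with vertex set `s` and all the edges of `D` between vertices of `s`. -/
def induced (D : Digraph V) (s : Finset V) : Digraph {v // v ∈ s} :=
  ⟨fun u v => D.Adj u.1 v.1⟩

theorem IsAromatic.induced {D : Digraph V} (hD : IsAromatic D) (s : Finset V) :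
    IsAromatic (induced D s) :=
  fun u v w huv huw => Subtype.ext (hD u.1 v.1 w.1 huv huw)

variable [Fintype V]

open Classical in
/-- The roots: vertices without outgoing edges. -/
def roots (D : Digraph V) : Finset V :=
  Finset.univ.filter fun u => ∀ v, ¬ D.Adj u v

open Classical in
/-- The direct predecessors of `p`: vertices `q` with an edge from `q` to `p`. -/
def preds (D : Digraph V) (p : V) : Finset V :=
  Finset.univ.filter fun q => D.Adj q p

open Classical in
/-- The admissible partitions of `D`.  A partition of the graph into two subgraphs `R` and `P*`
is given by the vertex set of `R` (that of `P*` is the complement `Rᶜ`); it is admissible if no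
edge goes from `R` to `P*`. -/
def admissible (D : Digraph V) : Finset (Finset V) :=
  Finset.univ.filter fun R => ∀ u ∈ R, ∀ v ∉ R, ¬ D.Adj u v

/-- The size of the automorphism group. -/
def autCard (D : Digraph V) : ℕ := Nat.card (D.Adj ≃r D.Adj)

end Graphs

/-! ### Aromatic forests -/

/-- Directed graphs with at most one outgoing edge per vertex, on the vertex sets `Fin k`. -/
def FinGraph : Type := Σ k : ℕ, {D : Digraph (Fin k) // IsAromatic D}

/-- Equivalence of directed graphs. -/
instance finGraphSetoid : Setoid FinGraph where
  r D D' := Nonempty (D.2.1.Adj ≃r D'.2.1.Adj)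
  iseqv :=
    ⟨fun _ => ⟨RelIso.refl _⟩, fun ⟨e⟩ => ⟨e.symm⟩, fun ⟨e⟩ ⟨e'⟩ => ⟨e.trans e'⟩⟩

/-- The set `AF` of aromatic forests: equivalence classes of finite directed graphs in which every
vertex has at most one outgoing edge. -/
def AromaticForest : Type := Quotient finGraphSetoid

/-- A copy of `D` with vertex set `Fin k`. -/
def toFinGraph {V : Type*} [Fintype V] (D : Digraph V) (hD : IsAromatic D) : FinGraph :=
  ⟨Fintype.card V, ⟨fun i j => D.Adj ((Fintype.equivFin V).symm i) ((Fintype.equivFin V).symm j)⟩,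
    fun _ _ _ huv huw => (Fintype.equivFin V).symm.injective (hD _ _ _ huv huw)⟩

/-- The copy is equivalent to the original. -/
def toFinGraphIso {V : Type*} [Fintype V] (D : Digraph V) (hD : IsAromatic D) :
    (toFinGraph D hD).2.1.Adj ≃r D.Adj where
  toEquiv := (Fintype.equivFin V).symm
  map_rel_iff' := Iff.rfl

/-- The aromatic forest (equivalence class) of a graph on an arbitrary finite vertex set. -/
def forestOf {V : Type*} [Fintype V] (D : Digraph V) (hD : IsAromatic D) : AromaticForest :=
  Quotient.mk finGraphSetoid (toFinGraph D hD)

/-- Two graphs give the same aromatic forest exactly when they are equivalent. -/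
theorem forestOf_eq_iff {V W : Type*} [Fintype V] [Fintype W] {D : Digraph V} {D' : Digraph W}
    (hD : IsAromatic D) (hD' : IsAromatic D') :
    forestOf D hD = forestOf D' hD' ↔ Nonempty (D.Adj ≃r D'.Adj) := by
  refine Quotient.eq.trans ⟨fun ⟨e⟩ => ⟨?_⟩, fun ⟨e⟩ => ⟨?_⟩⟩
  · exact ((toFinGraphIso D hD).symm.trans e).trans (toFinGraphIso D' hD')
  · exact ((toFinGraphIso D hD).trans e).trans (toFinGraphIso D' hD').symm

/-- The number of vertices `|φ|`. -/
def AromaticForest.size (φ : AromaticForest) : ℕ :=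
  Quotient.lift (s := finGraphSetoid) (fun D : FinGraph => D.1)
    (fun _ _ h => h.elim fun e => by simpa using Fintype.card_congr e.toEquiv) φ

/-- The symmetry `σ(φ)`: the size of the automorphism group of `φ`. -/
def AromaticForest.sigma (φ : AromaticForest) : ℕ :=
  Quotient.lift (s := finGraphSetoid) (fun D : FinGraph => autCard D.2.1)
    (fun _ _ h => h.elim fun e => Nat.card_congr
      ⟨fun g => (e.symm.trans g).trans e, fun g => (e.trans g).trans e.symm,
        fun g => by ext; simp, fun g => by ext; simp⟩) φ

/-- The aromatic forest of a graph on `Fin k`. -/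
def ofFin {k : ℕ} (D : {D : Digraph (Fin k) // IsAromatic D}) : AromaticForest :=
  Quotient.mk finGraphSetoid (Sigma.mk k D : FinGraph)

/-- The finite set of aromatic forests with `k` vertices. -/
def forestsOfSize (k : ℕ) : Finset AromaticForest :=
  (Set.finite_range fun D : {D : Digraph (Fin k) // IsAromatic D} => ofFin D).toFinset

theorem mem_forestsOfSize {k : ℕ} {φ : AromaticForest} : φ ∈ forestsOfSize k ↔ φ.size = k := by
  rw [forestsOfSize, Set.Finite.mem_toFinset]
  constructor
  · rintro ⟨D, rfl⟩
    rfl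
  · rintro rfl
    induction φ using Quotient.inductionOn with
    | h D => exact ⟨D.2, rfl⟩

/-! ### Elemental differential operators -/

section ElementalDifferentials

variable {K : Type*} [RCLike K] {n : ℕ} {W : Type*} [NormedAddCommGroup W] [NormedSpace K W]

/-- The partial derivative `∂g/∂x_i`. -/
def pderiv (i : Fin n) (g : (Fin n → K) → W) : (Fin n → K) → W :=
  fun x => fderiv K g x (Pi.single i 1)

/-- The partial derivative `∂^m g / ∂x_{i_1} ⋯ ∂x_{i_m}` for a multiindex `I = i_1 ⋯ i_m`, which is
an unordered list of coordinate directions; the derivatives are taken one after the other. -/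
def mderiv (I : Multiset (Fin n)) (g : (Fin n → K) → W) : (Fin n → K) → W :=
  (I.sort (· ≤ ·)).foldr pderiv g

/-- The elemental differential operator of a graph: the sum over all assignments of indices `i_p`
to the vertices `p` of
`∏_p (∂_{I_π(p)} f^{i_p}) • (∏_{s root} ∂_{i_s}) G`, where `I_π(p)` is the multiindex of the
indices of the direct predecessors of `p`. -/
def elemDiffGraph {V : Type*} [Fintype V] (D : Digraph V) (f : (Fin n → K) → (Fin n → K))
    (G : (Fin n → K) → W) : (Fin n → K) → W :=
  open Classical in
  fun x => ∑ i : V → Fin n,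
    (∏ p : V, mderiv ((preds D p).val.map i) (fun y => f y (i p)) x) •
      mderiv ((roots D).val.map i) G x

/-- Equivalent graphs have the same elemental differential operator. -/
theorem elemDiffGraph_congr {V V' : Type*} [Fintype V] [Fintype V'] {D : Digraph V}
    {D' : Digraph V'} (e : D.Adj ≃r D'.Adj) (f : (Fin n → K) → (Fin n → K))
    (G : (Fin n → K) → W) : elemDiffGraph D f G = elemDiffGraph D' f G := by
  classical
  obtain ⟨E, hE⟩ : ∃ E : V ≃ V', ∀ u v, D'.Adj (E u) (E v) ↔ D.Adj u v :=
    ⟨e.toEquiv, fun _ _ => e.map_rel_iff⟩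
  have hp : ∀ p, preds D' (E p) = (preds D p).map E.toEmbedding := by
    intro p
    ext q
    obtain ⟨q, rfl⟩ := E.surjective q
    simp [preds, hE]
  have hr : roots D' = (roots D).map E.toEmbedding := by
    ext q
    obtain ⟨q, rfl⟩ := E.surjective q
    simp [roots, E.surjective.forall, hE]
  funext x
  refine Fintype.sum_equiv (E.arrowCongr (Equiv.refl _)) _ _ fun i => ?_
  congr 1
  · refine Fintype.prod_equiv E _ _ fun p => ?_
    rw [hp p]
    simp [Function.comp_def]
  · rw [hr]
    simp [Function.comp_def]

/-- The elemental differential operator `F_f(φ)` of an aromatic forest. -/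
def elemDiff (f : (Fin n → K) → (Fin n → K)) (φ : AromaticForest) (G : (Fin n → K) → W) :
    (Fin n → K) → W :=
  Quotient.lift (s := finGraphSetoid) (fun D : FinGraph => elemDiffGraph D.2.1 f G)
    (fun _ _ h => h.elim fun e => elemDiffGraph_congr e f G) φ

end ElementalDifferentials

/-! ### The coalgebra of aromatic forests and the composition product -/

section Coalgebra

variable (𝕜 : Type*) [RCLike 𝕜]

/-- The free vector space `C_AF` on the set of aromatic forests. -/
abbrev ForestSpace : Type _ := AromaticForest →₀ 𝕜

variable {𝕜}

/-- The sum of `c(P*(p), R(p))` over all admissible partitions `p` of a graph. -/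
def partitionSum {M : Type*} [AddCommMonoid M] (c : AromaticForest → AromaticForest → M)
    {V : Type*} [Fintype V] (D : Digraph V) (hD : IsAromatic D) : M :=
  open Classical in
  ∑ R ∈ admissible D,
    c (forestOf (induced D Rᶜ) (hD.induced Rᶜ)) (forestOf (induced D R) (hD.induced R))

theorem partitionSum_congr {M : Type*} [AddCommMonoid M]
    (c : AromaticForest → AromaticForest → M) {V V' : Type*} [Fintype V] [Fintype V']
    {D : Digraph V} {D' : Digraph V'} (hD : IsAromatic D) (hD' : IsAromatic D')
    (e : D.Adj ≃r D'.Adj) : partitionSum c D hD = partitionSum c D' hD' := by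
  classical
  obtain ⟨E, hE⟩ : ∃ E : V ≃ V', ∀ u v, D'.Adj (E u) (E v) ↔ D.Adj u v :=
    ⟨e.toEquiv, fun _ _ => e.map_rel_iff⟩
  have key : ∀ (s : Finset V) (t : Finset V'), (∀ v, v ∈ s ↔ E v ∈ t) →
      forestOf (induced D s) (hD.induced s) = forestOf (induced D' t) (hD'.induced t) := by
    intro s t h
    rw [forestOf_eq_iff]
    exact ⟨⟨E.subtypeEquiv h, hE _ _⟩⟩
  unfold partitionSum
  refine Finset.sum_equiv E.finsetCongr (fun R => ?_) (fun R _ => ?_)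
  · simp [admissible, E.surjective.forall, hE]
  · congr 1
    · exact key _ _ fun v => by simp
    · exact key _ _ fun v => by simp

/-- The coproduct of an aromatic forest, `Δ(φ) = ∑_p P*(p) ⊗ R(p)`, the sum over the admissible
partitions of `φ`. -/
def coproductForest (φ : AromaticForest) : ForestSpace 𝕜 ⊗[𝕜] ForestSpace 𝕜 :=
  Quotient.lift (s := finGraphSetoid)
    (fun D : FinGraph => partitionSum
      (fun P R => (Finsupp.single P (1 : 𝕜) : ForestSpace 𝕜) ⊗ₜ[𝕜]
        (Finsupp.single R (1 : 𝕜) : ForestSpace 𝕜)) D.2.1 D.2.2)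
    (fun D D' h => h.elim fun e => partitionSum_congr _ D.2.2 D'.2.2 e) φ

/-- The coproduct `Δ_AF`, extended linearly. -/
def coproduct : ForestSpace 𝕜 →ₗ[𝕜] ForestSpace 𝕜 ⊗[𝕜] ForestSpace 𝕜 :=
  Finsupp.linearCombination 𝕜 coproductForest

/-- The composition product `b · a = (b ⊗ a) ∘ Δ_AF`. -/
def compProd (b a : Module.Dual 𝕜 (ForestSpace 𝕜)) : Module.Dual 𝕜 (ForestSpace 𝕜) :=
  LinearMap.mul' 𝕜 𝕜 ∘ₗ TensorProduct.map b a ∘ₗ coproduct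

/-- The coefficient `a(φ)`. -/
def coeff (a : Module.Dual 𝕜 (ForestSpace 𝕜)) (φ : AromaticForest) : 𝕜 :=
  a (Finsupp.single φ 1)

end Coalgebra

/-! ### Aromatic S-series

The formal sum over all aromatic forests is graded by the number of vertices: a formal series
`∑_m h^m G_m` of functions is the sequence `m ↦ G_m`, a function `G` is the series
`Pi.single 0 G`, and `S_f(a) = ∑_φ h^|φ| a(φ) / σ(φ) F_f(φ)` acts linearly over `h`. -/

section SSeries

variable {K : Type*} [RCLike K] {n : ℕ} {W : Type*} [NormedAddCommGroup W] [NormedSpace K W]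
variable {𝕜 : Type*} [RCLike 𝕜] [NormedSpace 𝕜 W]

/-- The part of `S_f(a)[G]` of degree `k`: the sum over the aromatic forests with `k` vertices. -/
def sSeriesPart (f : (Fin n → K) → (Fin n → K)) (a : Module.Dual 𝕜 (ForestSpace 𝕜)) (k : ℕ)
    (G : (Fin n → K) → W) : (Fin n → K) → W :=
  ∑ φ ∈ forestsOfSize k, (coeff a φ / (φ.sigma : 𝕜)) • elemDiff f φ G

/-- The aromatic S-series `S_f(a)` as an operator on formal series of functions. -/
def sSeries (f : (Fin n → K) → (Fin n → K)) (a : Module.Dual 𝕜 (ForestSpace 𝕜))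
    (G : ℕ → (Fin n → K) → W) : ℕ → (Fin n → K) → W :=
  fun m => ∑ kl ∈ Finset.HasAntidiagonal.antidiagonal m, sSeriesPart f a kl.1 (G kl.2)

end SSeries

end Aromatic

end

/-!
A graph with at most one outgoing edge per vertex is the same thing as a map `s : V → Option V`, and
an aromatic forest `φ` with `k` vertices has exactly `k! / σ(φ)` labellings by a fixed set of `k`
vertices (`card_labellings_mul_sigma`).  Hence `k!` times the part of degree `k` of an S-series is
the plain sum of `a(s) F_f(s)` over all labelled graphs `s` (`sum_coeff_smul_elemDiffGraph`), and
symmetry factors disappear from the argument.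

Composing the operators of labelled graphs `d₁` on `P` and `d₂` on `Q` is the Leibniz rule: the
derivative of each root of `d₁` hits the factor `∂f` of some vertex of `d₂` or the function `G`.  Each
choice gives the operator of a graph on `P ⊕ Q` in which that root is joined to the chosen vertex, or
stays a root (`elemDiffGraph_comp`).  The graphs so obtained are exactly those without an edge from `Q`
to `P`, each obtained once (`sum_relabel_glue`), i.e. those for which `(P, Q)` is an admissible
partition.

Summing over all vertex sets `R = Q` of a fixed set of `k` vertices, each `R` with `l` elements
contributes `(k - l)! l!` times the composition of the parts of degrees `k - l` and `l`
(`sum_admissible_eq`); there are `k.choose l` of them, and the factor `k!` cancels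
(`sSeriesPart_compProd`).  The law for formal series in `h` is the associativity of the Cauchy product.
-/

noncomputable section

namespace Aromatic

/-! ### Partial derivatives and the Leibniz rule -/

section Derivatives

variable {K : Type*} [RCLike K] {n : ℕ} {W : Type*} [NormedAddCommGroup W] [NormedSpace K W]

theorem contDiff_pderiv (i : Fin n) {g : (Fin n → K) → W} (hg : ContDiff K ∞ g) :
    ContDiff K ∞ (pderiv i g) :=
  (hg.fderiv_right (m := ∞) (by simp)).clm_apply contDiff_const

theorem pderiv_comm (i j : Fin n) {g : (Fin n → K) → W} (hg : ContDiff K ∞ g) :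
    pderiv i (pderiv j g) = pderiv j (pderiv i g) := by
  have hd : Differentiable K (fderiv K g) :=
    (hg.fderiv_right (m := ∞) (by simp)).differentiable (by simp)
  have key : ∀ (a b : Fin n) (x), pderiv a (pderiv b g) x =
      fderiv K (fderiv K g) x (Pi.single a 1) (Pi.single b 1) := by
    intro a b x
    unfold pderiv
    rw [fderiv_clm_apply (hd x) (differentiableAt_const _)]
    simp
  funext x
  rw [key, key]
  refine (ContDiffAt.isSymmSndFDerivAt (n := ∞) hg.contDiffAt ?_).eq _ _
  rw [minSmoothness_of_isRCLikeNormedField]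
  exact WithTop.coe_le_coe.2 le_top

theorem contDiff_foldr_pderiv (l : List (Fin n)) {g : (Fin n → K) → W} (hg : ContDiff K ∞ g) :
    ContDiff K ∞ (l.foldr pderiv g) := by
  induction l with
  | nil => exact hg
  | cons i l ih => exact contDiff_pderiv i ih

theorem foldr_pderiv_perm {l l' : List (Fin n)} (h : l.Perm l') {g : (Fin n → K) → W}
    (hg : ContDiff K ∞ g) : l.foldr pderiv g = l'.foldr pderiv g := by
  induction h with
  | nil => rfl
  | cons i _ ih => simp only [List.foldr_cons, ih]
  | swap i j l => exact pderiv_comm _ _ (contDiff_foldr_pderiv l hg)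
  | trans _ _ ih ih' => exact ih.trans ih'

theorem contDiff_mderiv (I : Multiset (Fin n)) {g : (Fin n → K) → W} (hg : ContDiff K ∞ g) :
    ContDiff K ∞ (mderiv I g) :=
  contDiff_foldr_pderiv _ hg

theorem mderiv_zero (g : (Fin n → K) → W) : mderiv 0 g = g := by
  simp [mderiv]

/-- The order of the derivatives does not matter for a smooth function, so the sorting in `mderiv`
is harmless. -/
theorem mderiv_cons (i : Fin n) (I : Multiset (Fin n)) {g : (Fin n → K) → W}
    (hg : ContDiff K ∞ g) : mderiv (i ::ₘ I) g = pderiv i (mderiv I g) :=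
  foldr_pderiv_perm (l' := i :: I.sort (· ≤ ·))
    (Multiset.coe_eq_coe.1 (by simp [← Multiset.cons_coe])) hg

theorem mderiv_add (I J : Multiset (Fin n)) {g : (Fin n → K) → W} (hg : ContDiff K ∞ g) :
    mderiv (I + J) g = mderiv I (mderiv J g) := by
  induction I using Multiset.induction_on with
  | empty => rw [zero_add, mderiv_zero]
  | cons i I ih => rw [Multiset.cons_add, mderiv_cons i _ hg, ih,
      mderiv_cons i _ (contDiff_mderiv J hg)]

theorem pderiv_sum (i : Fin n) {ι : Type*} (s : Finset ι) {g : ι → (Fin n → K) → W}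
    (hg : ∀ j ∈ s, ContDiff K ∞ (g j)) :
    pderiv i (∑ j ∈ s, g j) = ∑ j ∈ s, pderiv i (g j) := by
  funext x
  unfold pderiv
  rw [fderiv_sum fun j hj => (hg j hj).differentiable (by simp) x]
  simp

theorem mderiv_sum (I : Multiset (Fin n)) {ι : Type*} (s : Finset ι) {g : ι → (Fin n → K) → W}
    (hg : ∀ j ∈ s, ContDiff K ∞ (g j)) :
    mderiv I (∑ j ∈ s, g j) = ∑ j ∈ s, mderiv I (g j) := by
  have hs : ContDiff K ∞ (∑ j ∈ s, g j) := by
    simpa only [Finset.sum_fn] using ContDiff.sum hg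
  induction I using Multiset.induction_on with
  | empty => simp only [mderiv_zero]
  | cons i I ih =>
    rw [mderiv_cons i I hs, ih, pderiv_sum i s fun j hj => contDiff_mderiv I (hg j hj)]
    exact Finset.sum_congr rfl fun j hj => (mderiv_cons i I (hg j hj)).symm

theorem mderiv_const_smul {𝕜 : Type*} [RCLike 𝕜] [NormedSpace 𝕜 W] [SMulCommClass K 𝕜 W]
    (I : Multiset (Fin n)) (c : 𝕜) {g : (Fin n → K) → W} (hg : ContDiff K ∞ g) :
    mderiv I (c • g) = c • mderiv I g := by
  induction I using Multiset.induction_on with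
  | empty => simp only [mderiv_zero]
  | cons i I ih =>
    have hcg : ContDiff K ∞ (c • g) := hg.const_smul c
    rw [mderiv_cons i I hcg, ih, mderiv_cons i I hg]
    funext x
    unfold pderiv
    rw [fderiv_const_smul ((contDiff_mderiv I hg).differentiable (by simp) x)]
    rfl

/-- The Leibniz rule for one partial derivative of a product of the scalar functions `A q` with a
vector valued function `B`; the label `some q` stands for the factor `A q` and `none` for `B`. -/
theorem pderiv_prod_smul (j : Fin n) {Q : Type*} [Fintype Q] [DecidableEq Q]
    {A : Q → (Fin n → K) → K} {B : (Fin n → K) → W} (hA : ∀ q, ContDiff K ∞ (A q))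
    (hB : ContDiff K ∞ B) :
    pderiv j (fun x => (∏ q, A q x) • B x) = ∑ c : Option Q, fun x =>
      (∏ q, (if c = some q then pderiv j (A q) else A q) x) •
        (if c = none then pderiv j B else B) x := by
  have hA' : ∀ q x, DifferentiableAt K (A q) x := fun q x => (hA q).differentiable (by simp) x
  have hB' : ∀ x, DifferentiableAt K B x := fun x => hB.differentiable (by simp) x
  funext x
  have hprod : HasFDerivAt (fun y => ∏ q, A q y)
      (∑ q, (∏ r ∈ Finset.univ.erase q, A r x) • fderiv K (A q) x) x :=
    HasFDerivAt.finsetProd fun q _ => (hA' q x).hasFDerivAt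
  have h := (hprod.smul (hB' x).hasFDerivAt).fderiv
  rw [Finset.sum_apply, Fintype.sum_option]
  unfold pderiv
  rw [show fderiv K (fun x => (∏ q, A q x) • B x) x = _ from h]
  simp only [add_apply, smul_apply,
    ContinuousLinearMap.smulRight_apply, sum_apply, reduceCtorEq, if_true,
    if_false, Option.some.injEq, Finset.sum_smul]
  congr 1
  refine Finset.sum_congr rfl fun q _ => ?_
  congr 1
  rw [← Finset.mul_prod_erase _ _ (Finset.mem_univ q), if_pos rfl, smul_eq_mul, mul_comm]
  congr 1
  exact Finset.prod_congr rfl fun r hr => by rw [if_neg (Finset.ne_of_mem_erase hr).symm]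

/-- The multiindex of the elements of `S` to which `t` gives the label `c`. -/
def fiberIndex {S T : Type*} [Fintype S] (i : S → Fin n) (t : S → T) (c : T) :
    Multiset (Fin n) :=
  open Classical in (Finset.univ.filter fun u => t u = c).val.map i

/-- The multiindices of two fibres agree when an embedding carries one fibre onto the other. -/
theorem fiberIndex_embedding {S S' T T' : Type*} [Fintype S] [Fintype S'] (e : S ↪ S')
    (i : S' → Fin n) {t : S → T} {t' : S' → T'} {c : T} {c' : T'}
    (h : ∀ u', t' u' = c' ↔ ∃ u, e u = u' ∧ t u = c) :
    fiberIndex i t' c' = fiberIndex (fun u => i (e u)) t c := by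
  classical
  have hf : (Finset.univ.filter fun u => t' u = c') =
      (Finset.univ.filter fun u => t u = c).map e := by
    ext u'
    simp [h, and_comm]
  unfold fiberIndex
  rw [hf, Finset.map_val, Multiset.map_map]
  rfl

theorem fiberIndex_sum {P Q T : Type*} [Fintype P] [Fintype Q] (i : P ⊕ Q → Fin n)
    (t : P ⊕ Q → T) (c : T) :
    fiberIndex i t c = fiberIndex (fun u => i (Sum.inl u)) (fun u => t (Sum.inl u)) c +
      fiberIndex (fun u => i (Sum.inr u)) (fun u => t (Sum.inr u)) c := by
  classical
  have h : (Finset.univ : Finset (P ⊕ Q)).val =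
      Finset.univ.val.map Sum.inl + Finset.univ.val.map Sum.inr := rfl
  unfold fiberIndex
  simp [Finset.filter_val, h, Multiset.filter_map]

theorem fiberIndex_option {S T : Type*} [Fintype S] [DecidableEq T] (i : Option S → Fin n)
    (t : Option S → T) (c : T) :
    fiberIndex i t c = if t none = c then i none ::ₘ fiberIndex (i ∘ some) (t ∘ some) c
      else fiberIndex (i ∘ some) (t ∘ some) c := by
  classical
  have h : (Finset.univ : Finset (Option S)).val = none ::ₘ Finset.univ.val.map some := rfl
  unfold fiberIndex
  simp only [Finset.filter_val, h, Multiset.filter_cons, Multiset.filter_map]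
  split_ifs <;> simp

/-- The Leibniz rule for a mixed derivative: each derivation `∂_{i u}`, `u : S`, is applied to one
of the factors, and `t : S → Option Q` records to which one. -/
theorem mderiv_prod_smul {S : Type*} [Fintype S] {Q : Type*} [Fintype Q]
    {A : Q → (Fin n → K) → K} {B : (Fin n → K) → W} (hA : ∀ q, ContDiff K ∞ (A q))
    (hB : ContDiff K ∞ B) (i : S → Fin n) [DecidableEq S] :
    mderiv (Finset.univ.val.map i) (fun x => (∏ q, A q x) • B x) =
      ∑ t : S → Option Q, fun x =>
        (∏ q, mderiv (fiberIndex i t (some q)) (A q) x) • mderiv (fiberIndex i t none) B x := by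
  classical
  have smooth : ∀ {A : Q → (Fin n → K) → K} {B : (Fin n → K) → W},
      (∀ q, ContDiff K ∞ (A q)) → ContDiff K ∞ B →
      ContDiff K ∞ (fun x => (∏ q, A q x) • B x) := fun hA hB =>
    (contDiff_prod fun q _ => hA q).smul hB
  suffices H : ∀ (S : Type _) [Fintype S] (i : S → Fin n),
      mderiv (Finset.univ.val.map i) (fun x => (∏ q, A q x) • B x) =
      ∑ t : S → Option Q, fun x =>
        (∏ q, mderiv (fiberIndex i t (some q)) (A q) x) • mderiv (fiberIndex i t none) B x by
    convert H S i
  refine Fintype.induction_empty_option ?_ ?_ ?_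
  · intro S S' _ e ih i
    let _ := Fintype.ofEquiv S' e.symm
    have hi : (Finset.univ.val.map i) = Finset.univ.val.map (i ∘ e) := by
      rw [← Finset.univ_map_equiv_to_embedding e, Finset.map_val, Multiset.map_map]
      rfl
    rw [hi, ih]
    refine Fintype.sum_equiv (e.arrowCongr (Equiv.refl _)) _ _ fun t => ?_
    have ht : ∀ c, fiberIndex i (e.arrowCongr (Equiv.refl (Option Q)) t) c =
        fiberIndex (i ∘ e) t c := fun c =>
      fiberIndex_embedding e.toEmbedding i fun u' =>
        ⟨fun h => ⟨e.symm u', by simp, h⟩, by rintro ⟨u, rfl, h⟩; simpa using h⟩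
    simp only [ht]
  · intro i
    simp [fiberIndex, mderiv_zero]
  · intro S _ ih i
    have hi : Finset.univ.val.map i = i none ::ₘ Finset.univ.val.map (i ∘ some) := by
      simp [univ_option, Finset.insertNone]
    rw [hi, mderiv_cons _ _ (smooth hA hB), ih, pderiv_sum _ _ fun t _ => smooth
      (fun q => contDiff_mderiv _ (hA q)) (contDiff_mderiv _ hB)]
    refine Eq.trans ?_ (Finset.sum_equiv (s := Finset.univ)
      (Equiv.piOptionEquivProd (β := fun _ : Option S => Option Q)).symm (by simp)
      fun _ _ => rfl)
    rw [Fintype.sum_prod_type_right]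
    refine Finset.sum_congr rfl fun t _ => ?_
    rw [pderiv_prod_smul _ (fun q => contDiff_mderiv _ (hA q)) (contDiff_mderiv _ hB)]
    refine Finset.sum_congr rfl fun c _ => ?_
    have h0 : (Equiv.piOptionEquivProd (β := fun _ : Option S => Option Q)).symm (c, t) none = c :=
      rfl
    have h1 : (Equiv.piOptionEquivProd (β := fun _ : Option S => Option Q)).symm (c, t) ∘ some = t :=
      rfl
    funext x
    simp only [fiberIndex_option, h0, h1]
    congr 1
    · refine Finset.prod_congr rfl fun q _ => ?_
      split_ifs
      · rw [mderiv_cons _ _ (hA q)]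
      · rfl
    · split_ifs
      · rw [mderiv_cons _ _ hB]
      · rfl

end Derivatives

/-! ### Labelled graphs as maps `V → Option V`, and orbit counting -/

section SuccessorMaps

variable {V : Type*}

/-- The graph with an edge from `u` to `v` whenever `s u = some v`.  Graphs with at most one
outgoing edge per vertex are encoded in this way by maps `s : V → Option V`, the value `none`
marking the roots. -/
def graphOf (s : V → Option V) : Digraph V := ⟨fun u v => s u = some v⟩

theorem isAromatic_graphOf (s : V → Option V) : IsAromatic (graphOf s) :=
  fun _ _ _ h h' => Option.some.inj (h.symm.trans h')

theorem exists_graphOf_eq {D : Digraph V} (hD : IsAromatic D) :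
    ∃ s : V → Option V, graphOf s = D := by
  classical
  refine ⟨fun u => if h : ∃ v, D.Adj u v then some h.choose else none, ?_⟩
  ext u v
  simp only [graphOf]
  split_ifs with h
  · rw [Option.some.injEq]
    exact ⟨fun e => e ▸ h.choose_spec, fun e => hD _ _ _ h.choose_spec e⟩
  · simpa using fun e => h ⟨v, e⟩

theorem card_relIso_eq_autCard {V' : Type*} {D : Digraph V} {D' : Digraph V'}
    (e : D.Adj ≃r D'.Adj) : Nat.card (D.Adj ≃r D'.Adj) = autCard D :=
  Nat.card_congr ⟨fun g => g.trans e.symm, fun g => g.trans e,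
    fun g => by ext; simp, fun g => by ext; simp⟩

variable [Fintype V]

/-- The aromatic forest of `graphOf s`. -/
def forest (s : V → Option V) : AromaticForest := forestOf (graphOf s) (isAromatic_graphOf s)

theorem size_forestOf (D : Digraph V) (hD : IsAromatic D) :
    (forestOf D hD).size = Fintype.card V := rfl

theorem sigma_forestOf (D : Digraph V) (hD : IsAromatic D) :
    (forestOf D hD).sigma = autCard D := by
  refine (card_relIso_eq_autCard (toFinGraphIso D hD)).symm.trans (Nat.card_congr ?_)
  exact ⟨fun g => (toFinGraphIso D hD).symm.trans g, fun g => (toFinGraphIso D hD).trans g,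
    fun g => by ext; simp, fun g => by ext; simp⟩

theorem exists_forest_eq {φ : AromaticForest} (hφ : φ.size = Fintype.card V) :
    ∃ s : V → Option V, forest s = φ := by
  induction φ using Quotient.inductionOn with
  | h D =>
  obtain ⟨k, D, hD⟩ := D
  obtain rfl : k = Fintype.card V := hφ
  let e := Fintype.equivFin V
  let D' : Digraph V := ⟨fun u v => D.Adj (e u) (e v)⟩
  have hD' : IsAromatic D' := fun _ _ _ h h' => e.injective (hD _ _ _ h h')
  obtain ⟨s, hs⟩ := exists_graphOf_eq hD'
  refine ⟨s, Quotient.sound ⟨(toFinGraphIso _ (isAromatic_graphOf s)).trans ⟨e, ?_⟩⟩⟩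
  rw [hs]

/-- Orbit counting: the number of labellings of an aromatic forest by the vertex set `V`, times
the order of its automorphism group, is the number of permutations of `V`. -/
theorem card_labellings_mul_sigma [DecidableEq V] [DecidableEq AromaticForest]
    {φ : AromaticForest} (hφ : φ.size = Fintype.card V) :
    (Finset.univ.filter fun s : V → Option V => forest s = φ).card * φ.sigma =
      (Fintype.card V).factorial := by
  classical
  obtain ⟨s₀, rfl⟩ := exists_forest_eq hφ
  have fin : ∀ s : V → Option V, Finite ((graphOf s₀).Adj ≃r (graphOf s).Adj) := fun s =>
    Finite.of_injective _ (RelIso.toEquiv_injective)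
  have hcard : ∀ s : V → Option V, Nat.card ((graphOf s₀).Adj ≃r (graphOf s).Adj) =
      if forest s = forest s₀ then (forest s₀).sigma else 0 := by
    intro s
    split_ifs with h
    · obtain ⟨e⟩ := (forestOf_eq_iff _ _).1 h.symm
      exact (card_relIso_eq_autCard e).trans (sigma_forestOf _ _).symm
    · have : IsEmpty ((graphOf s₀).Adj ≃r (graphOf s).Adj) :=
        ⟨fun e => h ((forestOf_eq_iff _ _).2 ⟨e.symm⟩)⟩
      exact Nat.card_of_isEmpty
  -- A permutation is an isomorphism onto exactly one graph, the one it transports `s₀` to.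
  have hbij : Function.Bijective
      (fun x : Σ s : V → Option V, (graphOf s₀).Adj ≃r (graphOf s).Adj => x.2.toEquiv) := by
    constructor
    · rintro ⟨s, e⟩ ⟨s', e'⟩ h
      have hs : ∀ (s : V → Option V) (e : (graphOf s₀).Adj ≃r (graphOf s).Adj) (u v : V),
          s (e.toEquiv u) = some (e.toEquiv v) ↔ s₀ u = some v := fun s e u v => e.map_rel_iff
      obtain rfl : s = s' := by
        funext w
        obtain ⟨u, rfl⟩ := e.toEquiv.surjective w
        refine Option.ext fun w' => ?_
        obtain ⟨v, rfl⟩ := e.toEquiv.surjective w'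
        have h1 := hs s e u v
        have h2 := hs s' e' u v
        rw [← show e.toEquiv = e'.toEquiv from h] at h2
        simpa using h1.trans h2.symm
      exact congrArg (Sigma.mk s) (RelIso.toEquiv_injective h)
    · intro π
      refine ⟨⟨fun v => (s₀ (π.symm v)).map π, ⟨π, ?_⟩⟩, rfl⟩
      intro u v
      simp [graphOf]
  have h := Nat.card_congr (Equiv.ofBijective _ hbij)
  rw [Nat.card_sigma, Nat.card_eq_fintype_card, Fintype.card_perm] at h
  rw [← h, Finset.sum_congr rfl fun s _ => hcard s, ← Finset.sum_filter, Finset.sum_const,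
    smul_eq_mul]

/-- Sums over aromatic forests weighted by `1 / σ` are, up to the number of permutations, sums
over labelled graphs. -/
theorem sum_forest {𝕜 M : Type*} [Field 𝕜] [CharZero 𝕜] [AddCommGroup M] [Module 𝕜 M]
    [DecidableEq V] (g : AromaticForest → M) :
    ∑ s : V → Option V, g (forest s) = ((Fintype.card V).factorial : 𝕜) •
      ∑ φ ∈ forestsOfSize (Fintype.card V), (φ.sigma : 𝕜)⁻¹ • g φ := by
  classical
  rw [← Finset.sum_fiberwise_of_maps_to (t := forestsOfSize (Fintype.card V)) (g := forest)
    fun s _ => mem_forestsOfSize.2 (size_forestOf _ _), Finset.smul_sum]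
  refine Finset.sum_congr rfl fun φ hφ => ?_
  have h := card_labellings_mul_sigma (V := V) (mem_forestsOfSize.1 hφ)
  have h0 : (φ.sigma : 𝕜) ≠ 0 := by
    rw [Nat.cast_ne_zero]
    rintro h0
    rw [h0, mul_zero] at h
    exact (Nat.factorial_pos _).ne h
  rw [Finset.sum_congr rfl fun s hs => by rw [(Finset.mem_filter.1 hs).2], Finset.sum_const,
    ← h, smul_smul, Nat.cast_mul, mul_assoc, mul_inv_cancel₀ h0, mul_one, Nat.cast_smul_eq_nsmul]

end SuccessorMaps

/-! ### Gluing graphs along an admissible partition -/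

section Gluing

variable {P Q : Type*}

/-- The graph on `P ⊕ Q` made of the graphs `d₁` on `P` and `d₂` on `Q` and of an edge from each
root `u` of `d₁` to the vertex `t u` of `Q`, if any. -/
def glue (d₁ : P → Option P) (d₂ : Q → Option Q) (t : {u // d₁ u = none} → Option Q) :
    P ⊕ Q → Option (P ⊕ Q) :=
  Sum.elim
    (fun u => if h : d₁ u = none then (t ⟨u, h⟩).map Sum.inr else (d₁ u).map Sum.inl)
    (fun q => (d₂ q).map Sum.inr)

variable (d₁ : P → Option P) (d₂ : Q → Option Q) (t : {u // d₁ u = none} → Option Q)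

theorem glue_inl_eq_inl (u p : P) : glue d₁ d₂ t (.inl u) = some (.inl p) ↔ d₁ u = some p := by
  by_cases h : d₁ u = none <;> simp [glue, h]

theorem glue_inl_eq_inr (u : P) (q : Q) :
    glue d₁ d₂ t (.inl u) = some (.inr q) ↔ ∃ h, t ⟨u, h⟩ = some q := by
  by_cases h : d₁ u = none <;> simp [glue, h]

theorem glue_inl_eq_none (u : P) :
    glue d₁ d₂ t (.inl u) = none ↔ ∃ h, t ⟨u, h⟩ = none := by
  by_cases h : d₁ u = none <;> simp [glue, h]

theorem glue_inr_eq_inl (q : Q) (p : P) : glue d₁ d₂ t (.inr q) ≠ some (.inl p) := by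
  simp [glue]

theorem glue_inr_eq_inr (q q' : Q) :
    glue d₁ d₂ t (.inr q) = some (.inr q') ↔ d₂ q = some q' := by
  simp [glue]

theorem glue_inr_eq_none (q : Q) : glue d₁ d₂ t (.inr q) = none ↔ d₂ q = none := by
  simp [glue]

/-- Relabelling the vertices of a graph. -/
def relabel {V' V : Type*} (e : V' ≃ V) (s : V' → Option V') : V → Option V :=
  fun v => (s (e.symm v)).map e

theorem relabel_apply_eq_some {V' V : Type*} (e : V' ≃ V) (s : V' → Option V') (u v : V') :
    relabel e s (e u) = some (e v) ↔ s u = some v := by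
  simp [relabel]

/-- Relabelled graphs are isomorphic. -/
def relabelIso {V' V : Type*} (e : V' ≃ V) (s : V' → Option V') :
    (graphOf s).Adj ≃r (graphOf (relabel e s)).Adj :=
  ⟨e, relabel_apply_eq_some e s _ _⟩

/-- The graphs without edges from `Q` to `P` are those obtained, in exactly one way, by gluing a
graph on `P` and a graph on `Q`. -/
theorem sum_relabel_glue {V M : Type*} [AddCommMonoid M] [Fintype P] [Fintype Q] [Fintype V]
    [DecidableEq P] [DecidableEq Q] [DecidableEq V] (e : P ⊕ Q ≃ V)
    (Φ : (V → Option V) → M)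
    [DecidablePred fun s : V → Option V => ∀ q p, s (e (.inr q)) ≠ some (e (.inl p))] :
    ∑ s : V → Option V with ∀ q p, s (e (.inr q)) ≠ some (e (.inl p)), Φ s =
      ∑ d₁ : P → Option P, ∑ d₂ : Q → Option Q, ∑ t : {u // d₁ u = none} → Option Q,
        Φ (relabel e (glue d₁ d₂ t)) := by
  classical
  simp only [← Fintype.sum_prod_type']
  rw [Finset.sum_sigma']
  symm
  refine Finset.sum_bij (fun x _ => relabel e (glue x.1 x.2.1 x.2.2)) ?_ ?_ ?_ fun _ _ => rfl
  · intro x _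
    rw [Finset.mem_filter]
    refine ⟨Finset.mem_univ _, fun q p h => ?_⟩
    exact glue_inr_eq_inl _ _ _ _ _ ((relabel_apply_eq_some e _ _ _).1 h)
  · rintro ⟨d₁, d₂, t⟩ - ⟨d₁', d₂', t'⟩ - h
    have h : ∀ u v, glue d₁ d₂ t u = some v ↔ glue d₁' d₂' t' u = some v := fun u v => by
      rw [← relabel_apply_eq_some e, ← relabel_apply_eq_some e]
      exact iff_of_eq (congrArg (· = _) (congrFun h _))
    obtain rfl : d₁ = d₁' := funext fun u => Option.ext fun p => by
      simpa only [glue_inl_eq_inl, Option.mem_def] using h (.inl u) (.inl p)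
    obtain rfl : d₂ = d₂' := funext fun u => Option.ext fun p => by
      simpa only [glue_inr_eq_inr, Option.mem_def] using h (.inr u) (.inr p)
    obtain rfl : t = t' := funext fun u => Option.ext fun p => by
      simpa only [glue_inl_eq_inr, Option.mem_def, u.2, exists_true_left] using h (.inl u) (.inr p)
    rfl
  · intro s hs
    replace hs := (Finset.mem_filter.1 hs).2
    let s' : P ⊕ Q → Option (P ⊕ Q) := relabel e.symm s
    have hs' : ∀ u v, s' u = some v ↔ s (e u) = some (e v) := fun u v => by
      simp [s', relabel, Equiv.symm_apply_eq]
    let d₁ : P → Option P := fun u => (s' (.inl u)).bind Sum.getLeft?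
    let d₂ : Q → Option Q := fun u => (s' (.inr u)).bind Sum.getRight?
    let t : {u // d₁ u = none} → Option Q := fun u => (s' (.inl u)).bind Sum.getRight?
    refine ⟨⟨d₁, d₂, t⟩, Finset.mem_univ _, ?_⟩
    suffices H : glue d₁ d₂ t = s' by
      funext v
      simp [H, s', relabel]
    funext u
    refine Option.ext fun v => ?_
    rcases u with u | u <;> rcases v with v | v
    · rw [glue_inl_eq_inl]
      simp [d₁, Option.bind_eq_some_iff]
    · rw [glue_inl_eq_inr]
      rcases h : s' (.inl u) with _ | (w | w) <;> simp [t, d₁, h]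
    · refine iff_of_false (glue_inr_eq_inl _ _ _ _ _) fun h => hs u v ((hs' _ _).1 h)
    · rw [glue_inr_eq_inr]
      simp [d₂, Option.bind_eq_some_iff]

end Gluing

/-! ### Composition of elemental differential operators -/

section Operators

variable {K : Type*} [RCLike K] {n : ℕ} {W : Type*} [NormedAddCommGroup W] [NormedSpace K W]
variable {f : (Fin n → K) → (Fin n → K)} {G : (Fin n → K) → W}

theorem elemDiffGraph_graphOf {V : Type*} [Fintype V] [DecidableEq V] (s : V → Option V)
    (f : (Fin n → K) → (Fin n → K)) (G : (Fin n → K) → W) :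
    elemDiffGraph (graphOf s) f G = ∑ i : V → Fin n, fun x =>
      (∏ p, mderiv (fiberIndex i s (some p)) (fun y => f y (i p)) x) •
        mderiv (fiberIndex i s none) G x := by
  have hr : ∀ i : V → Fin n, (roots (graphOf s)).val.map i = fiberIndex i s none := fun i => by
    unfold roots fiberIndex
    congr 3
    ext u
    exact Option.eq_none_iff_forall_ne_some.symm
  funext x
  rw [Finset.sum_apply]
  unfold elemDiffGraph
  simp only [hr]
  congr! 1
  ext i
  simp

theorem contDiff_elemDiffGraph {V : Type*} [Fintype V] (D : Digraph V) (hf : ContDiff K ∞ f)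
    (hG : ContDiff K ∞ G) : ContDiff K ∞ (elemDiffGraph D f G) :=
  ContDiff.sum fun i _ =>
    (contDiff_prod fun p _ => contDiff_mderiv _ (contDiff_pi.1 hf (i p))).smul
      (contDiff_mderiv _ hG)

theorem elemDiffGraph_sum {V ι : Type*} [Fintype V] (D : Digraph V) (s : Finset ι)
    {G : ι → (Fin n → K) → W} (hG : ∀ j ∈ s, ContDiff K ∞ (G j)) :
    elemDiffGraph D f (∑ j ∈ s, G j) = ∑ j ∈ s, elemDiffGraph D f (G j) := by
  funext x
  simp only [elemDiffGraph, Finset.sum_apply, mderiv_sum _ s hG, Finset.smul_sum]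
  exact Finset.sum_comm

theorem elemDiffGraph_const_smul {𝕜 : Type*} [RCLike 𝕜] [NormedSpace 𝕜 W] [SMulCommClass K 𝕜 W]
    {V : Type*} [Fintype V] (D : Digraph V) (c : 𝕜) (hG : ContDiff K ∞ G) :
    elemDiffGraph D f (c • G) = c • elemDiffGraph D f G := by
  funext x
  simp only [elemDiffGraph, Pi.smul_apply, mderiv_const_smul _ c hG, Finset.smul_sum]
  exact Finset.sum_congr rfl fun i _ => smul_comm _ _ _

/-- The composition of two elemental differential operators: by the Leibniz rule, the derivative
belonging to each root of `d₁` acts on the factor of one vertex of `d₂`, which creates an edge, or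
on `G`, which leaves a root. -/
theorem elemDiffGraph_comp {P Q : Type*} [Fintype P] [Fintype Q] [DecidableEq P] [DecidableEq Q]
    (d₁ : P → Option P) (d₂ : Q → Option Q) (hf : ContDiff K ∞ f) (hG : ContDiff K ∞ G) :
    elemDiffGraph (graphOf d₁) f (elemDiffGraph (graphOf d₂) f G) =
      ∑ t : {u // d₁ u = none} → Option Q, elemDiffGraph (graphOf (glue d₁ d₂ t)) f G := by
  have hf' : ∀ j, ContDiff K ∞ fun y => f y j := fun j => contDiff_pi.1 hf j
  -- The derivatives falling on the inner function are indexed by the roots of `d₁`.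
  have hroots : ∀ i : P → Fin n, fiberIndex i d₁ none =
      Finset.univ.val.map fun u : {u // d₁ u = none} => i u := fun i => by
    rw [fiberIndex_embedding (Function.Embedding.subtype fun u => d₁ u = none) i
      (t := fun _ => ()) (c := ()) (by simp)]
    simp [fiberIndex]
  have hinl : ∀ (i : P ⊕ Q → Fin n) t p, fiberIndex i (glue d₁ d₂ t) (some (.inl p)) =
      fiberIndex (fun u => i (.inl u)) d₁ (some p) := fun i t p =>
    fiberIndex_embedding Function.Embedding.inl i fun u' => by
      rcases u' with u | q
      · simp [glue_inl_eq_inl]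
      · simp [glue_inr_eq_inl]
  -- A vertex of `Q` keeps its predecessors in `d₂` and gains the roots of `d₁` sent to it; the
  -- same holds for the roots of the glued graph, with the label `none` in place of a vertex.
  have hQ : ∀ (i : P ⊕ Q → Fin n) t (c' : Option (P ⊕ Q)) (c : Option Q),
      (∀ u, glue d₁ d₂ t (.inl u) = c' ↔ ∃ h, t ⟨u, h⟩ = c) →
      (∀ q, glue d₁ d₂ t (.inr q) = c' ↔ d₂ q = c) →
      fiberIndex i (glue d₁ d₂ t) c' =
        fiberIndex (fun u : {u // d₁ u = none} => i (.inl u)) t c +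
          fiberIndex (fun q => i (.inr q)) d₂ c := by
    intro i t c' c h h'
    rw [fiberIndex_sum]
    congr 1
    · refine fiberIndex_embedding (Function.Embedding.subtype fun u => d₁ u = none)
        (fun u => i (.inl u)) fun u' => ?_
      rw [h]
      simp
    · exact fiberIndex_embedding (Function.Embedding.refl Q) (fun q => i (.inr q)) fun q => by
        simp [h']
  have hinr := fun i t q => hQ i t (some (.inr q)) (some q)
    (fun u => glue_inl_eq_inr d₁ d₂ t u q) (fun q' => glue_inr_eq_inr d₁ d₂ t q' q)
  have hnone := fun i t => hQ i t none none
    (fun u => glue_inl_eq_none d₁ d₂ t u) (fun q => glue_inr_eq_none d₁ d₂ t q)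
  have hsmooth : ∀ i : Q → Fin n, ContDiff K ∞ fun x =>
      (∏ q, mderiv (fiberIndex i d₂ (some q)) (fun y => f y (i q)) x) •
        mderiv (fiberIndex i d₂ none) G x := fun i =>
    (contDiff_prod fun q _ => contDiff_mderiv _ (hf' _)).smul (contDiff_mderiv _ hG)
  funext x
  rw [elemDiffGraph_graphOf, elemDiffGraph_graphOf]
  simp only [Finset.sum_apply, elemDiffGraph_graphOf (glue _ _ _),
    mderiv_sum _ _ fun i _ => hsmooth i, hroots,
    mderiv_prod_smul (fun q => contDiff_mderiv _ (hf' _)) (contDiff_mderiv _ hG),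
    ← (Equiv.sumArrowEquivProdArrow P Q (Fin n)).symm.sum_comp, Fintype.sum_prod_type,
    Fintype.prod_sum_type, hinl, hinr, hnone, mderiv_add _ _ (hf' _), mderiv_add _ _ hG,
    Finset.smul_sum, smul_smul]
  exact (Finset.sum_congr rfl fun i _ => Finset.sum_comm).trans Finset.sum_comm

theorem elemDiff_forestOf {V : Type*} [Fintype V] (D : Digraph V) (hD : IsAromatic D)
    (f : (Fin n → K) → (Fin n → K)) (G : (Fin n → K) → W) :
    elemDiff f (forestOf D hD) G = elemDiffGraph D f G :=
  elemDiffGraph_congr (toFinGraphIso D hD) f G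

end Operators

/-! ### S-series as sums over labelled graphs -/

section CompositionLaw

variable {𝕜 : Type*} [RCLike 𝕜]

theorem coproductForest_forestOf {V : Type*} [Fintype V] (D : Digraph V) (hD : IsAromatic D) :
    coproductForest (𝕜 := 𝕜) (forestOf D hD) = partitionSum
      (fun P R => (Finsupp.single P (1 : 𝕜) : ForestSpace 𝕜) ⊗ₜ[𝕜]
        (Finsupp.single R (1 : 𝕜) : ForestSpace 𝕜)) D hD :=
  partitionSum_congr (fun P R => (Finsupp.single P (1 : 𝕜) : ForestSpace 𝕜) ⊗ₜ[𝕜]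
    (Finsupp.single R (1 : 𝕜) : ForestSpace 𝕜)) (toFinGraph D hD).2.2 hD (toFinGraphIso D hD)

theorem coeff_compProd (a b : Module.Dual 𝕜 (ForestSpace 𝕜)) {V : Type*} [Fintype V]
    (D : Digraph V) (hD : IsAromatic D) :
    coeff (compProd b a) (forestOf D hD) =
      partitionSum (fun P R => coeff b P * coeff a R) D hD := by
  simp only [coeff, compProd, coproduct, LinearMap.comp_apply, Finsupp.linearCombination_single,
    one_smul]
  rw [coproductForest_forestOf]
  unfold partitionSum
  simp only [map_sum, TensorProduct.map_tmul, LinearMap.mul'_apply]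

variable {K : Type*} [RCLike K] {n : ℕ} {W : Type*} [NormedAddCommGroup W] [NormedSpace K W]
variable [NormedSpace 𝕜 W]
variable {f : (Fin n → K) → (Fin n → K)} {G : (Fin n → K) → W}

/-- The homogeneous parts of an aromatic S-series as sums over labelled graphs. -/
theorem sum_coeff_smul_elemDiffGraph (f : (Fin n → K) → (Fin n → K))
    (a : Module.Dual 𝕜 (ForestSpace 𝕜)) (G : (Fin n → K) → W) (V : Type*) [Fintype V]
    [DecidableEq V] :
    ∑ s : V → Option V, coeff a (forest s) • elemDiffGraph (graphOf s) f G =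
      ((Fintype.card V).factorial : 𝕜) • sSeriesPart f a (Fintype.card V) G := by
  have h := sum_forest (V := V) (𝕜 := 𝕜) fun φ => coeff a φ • elemDiff f φ G
  simp only [smul_smul] at h
  simpa only [sSeriesPart, forest, elemDiff_forestOf, div_eq_inv_mul] using h

theorem sSeriesPart_sum (a : Module.Dual 𝕜 (ForestSpace 𝕜)) (k : ℕ) {ι : Type*} (s : Finset ι)
    {G : ι → (Fin n → K) → W} (hG : ∀ j ∈ s, ContDiff K ∞ (G j)) :
    sSeriesPart f a k (∑ j ∈ s, G j) = ∑ j ∈ s, sSeriesPart f a k (G j) := by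
  have h : ∀ φ, elemDiff f φ (∑ j ∈ s, G j) = ∑ j ∈ s, elemDiff f φ (G j) := fun φ => by
    induction φ using Quotient.inductionOn with
    | h D => exact elemDiffGraph_sum D.2.1 s hG
  simp only [sSeriesPart, h, Finset.smul_sum]
  exact Finset.sum_comm

variable [SMulCommClass K 𝕜 W]

theorem contDiff_elemDiff (hf : ContDiff K ∞ f) (φ : AromaticForest) (hG : ContDiff K ∞ G) :
    ContDiff K ∞ (elemDiff f φ G) := by
  induction φ using Quotient.inductionOn with
  | h D => exact contDiff_elemDiffGraph D.2.1 hf hG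

theorem contDiff_sSeriesPart (hf : ContDiff K ∞ f) (a : Module.Dual 𝕜 (ForestSpace 𝕜)) (k : ℕ)
    (hG : ContDiff K ∞ G) : ContDiff K ∞ (sSeriesPart f a k G) := by
  have h : ContDiff K ∞ fun x => ∑ φ ∈ forestsOfSize k,
      (coeff a φ / (φ.sigma : 𝕜)) • elemDiff f φ G x := ContDiff.sum fun φ _ =>
    (contDiff_elemDiff hf φ hG).const_smul (coeff a φ / (φ.sigma : 𝕜))
  convert! h using 1
  funext x
  simp [sSeriesPart]

theorem sSeriesPart_const_smul (a : Module.Dual 𝕜 (ForestSpace 𝕜)) (k : ℕ) (c : 𝕜)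
    (hG : ContDiff K ∞ G) : sSeriesPart f a k (c • G) = c • sSeriesPart f a k G := by
  unfold sSeriesPart
  rw [Finset.smul_sum]
  refine Finset.sum_congr rfl fun φ _ => ?_
  have h : elemDiff f φ (c • G) = c • elemDiff f φ G := by
    induction φ using Quotient.inductionOn with
    | h D => exact elemDiffGraph_const_smul D.2.1 c hG
  rw [h, smul_comm]

/-- The contribution of all graphs on `V` for which a given vertex set `R` is the second part of
an admissible partition: such a graph is a graph on `R` and a graph on `Rᶜ` glued together, so
these contributions add up to a composition of operators. -/
theorem sum_admissible_eq (hf : ContDiff K ∞ f) (a b : Module.Dual 𝕜 (ForestSpace 𝕜))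
    (hG : ContDiff K ∞ G) {V : Type*} [Fintype V] [DecidableEq V] (R : Finset V)
    [DecidablePred fun s : V → Option V => R ∈ admissible (graphOf s)] :
    ∑ s : V → Option V with R ∈ admissible (graphOf s),
      (coeff b (forestOf (induced (graphOf s) Rᶜ) ((isAromatic_graphOf s).induced Rᶜ)) *
        coeff a (forestOf (induced (graphOf s) R) ((isAromatic_graphOf s).induced R))) •
          elemDiffGraph (graphOf s) f G =
      ((Rᶜ.card.factorial * R.card.factorial : ℕ) : 𝕜) •
        sSeriesPart f b Rᶜ.card (sSeriesPart f a R.card G) := by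
  classical
  let e : {v // v ∈ Rᶜ} ⊕ {v // v ∈ R} ≃ V := Equiv.ofBijective (Sum.elim (↑) (↑)) <| by
    constructor
    · rintro (⟨u, hu⟩ | ⟨u, hu⟩) (⟨v, hv⟩ | ⟨v, hv⟩) h <;> simp_all
      all_goals simp_all [show u = v from h]
    · intro v
      by_cases h : v ∈ R
      · exact ⟨.inr ⟨v, h⟩, rfl⟩
      · exact ⟨.inl ⟨v, Finset.mem_compl.2 h⟩, rfl⟩
  have hadm : ∀ s : V → Option V, R ∈ admissible (graphOf s) ↔
      ∀ q p, s (e (.inr q)) ≠ some (e (.inl p)) := fun s => by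
    simp only [admissible, Finset.mem_filter, Finset.mem_univ, true_and, Subtype.forall,
      Finset.mem_compl]
    rfl
  simp only [hadm]
  rw [sum_relabel_glue e]
  have hfst : ∀ d₁ d₂ t, forestOf (induced (graphOf (relabel e (glue d₁ d₂ t))) Rᶜ)
      ((isAromatic_graphOf _).induced Rᶜ) = forest d₁ := fun d₁ d₂ t =>
    (forestOf_eq_iff _ _).2 ⟨⟨Equiv.refl _, fun {u v} =>
      ((relabel_apply_eq_some e _ (.inl u) (.inl v)).trans
        (glue_inl_eq_inl d₁ d₂ t u v)).symm⟩⟩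
  have hsnd : ∀ d₁ d₂ t, forestOf (induced (graphOf (relabel e (glue d₁ d₂ t))) R)
      ((isAromatic_graphOf _).induced R) = forest d₂ := fun d₁ d₂ t =>
    (forestOf_eq_iff _ _).2 ⟨⟨Equiv.refl _, fun {u v} =>
      ((relabel_apply_eq_some e _ (.inr u) (.inr v)).trans
        (glue_inr_eq_inr d₁ d₂ t u v)).symm⟩⟩
  have hsmooth : ∀ d : {v // v ∈ R} → Option {v // v ∈ R},
      ContDiff K ∞ (coeff a (forest d) • elemDiffGraph (graphOf d) f G) := fun d =>
    (contDiff_elemDiffGraph (graphOf d) hf hG).const_smul (coeff a (forest d))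
  have hP := sum_coeff_smul_elemDiffGraph f b (sSeriesPart f a R.card G) {v // v ∈ Rᶜ}
  have hQ := sum_coeff_smul_elemDiffGraph f a G {v // v ∈ R}
  rw [Fintype.card_coe] at hP hQ
  rw [mul_comm, Nat.cast_mul, mul_smul, ← hP, Finset.smul_sum]
  refine Finset.sum_congr rfl fun d₁ _ => ?_
  rw [smul_comm, ← elemDiffGraph_const_smul _ _ (contDiff_sSeriesPart hf a _ hG), ← hQ,
    elemDiffGraph_sum _ _ fun d _ => hsmooth d, Finset.smul_sum]
  refine Finset.sum_congr rfl fun d₂ _ => ?_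
  rw [elemDiffGraph_const_smul _ _ (contDiff_elemDiffGraph _ hf hG), elemDiffGraph_comp d₁ d₂ hf hG,
    smul_smul, Finset.smul_sum]
  refine Finset.sum_congr rfl fun t _ => ?_
  rw [hfst, hsnd, ← elemDiffGraph_congr (relabelIso e (glue d₁ d₂ t))]

/-- The composition law in each degree. -/
theorem sSeriesPart_compProd (hf : ContDiff K ∞ f) (a b : Module.Dual 𝕜 (ForestSpace 𝕜)) (k : ℕ)
    (hG : ContDiff K ∞ G) :
    sSeriesPart f (compProd b a) k G = ∑ kl ∈ Finset.HasAntidiagonal.antidiagonal k,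
      sSeriesPart f b kl.1 (sSeriesPart f a kl.2 G) := by
  classical
  have h0 : (k.factorial : 𝕜) ≠ 0 := Nat.cast_ne_zero.2 k.factorial_ne_zero
  -- After multiplication by `k!` both sides are sums over labelled graphs on `Fin k`.
  refine smul_right_injective _ h0 ?_
  have h := sum_coeff_smul_elemDiffGraph f (compProd b a) G (Fin k)
  rw [Fintype.card_fin] at h
  change (k.factorial : 𝕜) • _ = (k.factorial : 𝕜) • _
  rw [← h]
  simp only [forest, coeff_compProd, partitionSum, Finset.sum_smul]
  rw [Finset.sum_comm' (t' := Finset.univ)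
    (s' := fun R => Finset.univ.filter fun s => R ∈ admissible (graphOf s)) (by simp)]
  -- The sum over `R` depends on `#R` only, and `k.choose l * (l! * (k - l)!) = k!`.
  have hR : ∀ R : Finset (Fin k), Rᶜ.card = k - R.card := fun R => by
    rw [Finset.card_compl, Fintype.card_fin]
  have key := Finset.sum_powerset_apply_card (x := (Finset.univ : Finset (Fin k)))
    fun l => (((k - l).factorial * l.factorial : ℕ) : 𝕜) •
      sSeriesPart f b (k - l) (sSeriesPart f a l G)
  rw [Finset.powerset_univ, Finset.card_univ, Fintype.card_fin] at key
  rw [← Finset.Nat.sum_antidiagonal_swap, Finset.Nat.sum_antidiagonal_eq_sum_range_succ_mk,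
    Finset.smul_sum]
  refine Eq.trans (Finset.sum_congr rfl fun R _ => ?_) (key.trans ?_)
  · rw [← hR R, ← sum_admissible_eq hf a b hG R]
    congr!
  · refine Finset.sum_congr rfl fun l hl => ?_
    have hc := Nat.choose_mul_factorial_mul_factorial (Finset.mem_range_succ_iff.1 hl)
    rw [← Nat.cast_smul_eq_nsmul 𝕜, smul_smul, ← Nat.cast_mul, ← hc, mul_assoc (k.choose l),
      mul_comm l.factorial]
    rfl

end CompositionLaw

end Aromatic

end

theorem theorem4p1 {𝕜 : Type*} [RCLike 𝕜]
    (a b : Module.Dual 𝕜 (Aromatic.ForestSpace 𝕜)) :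
    (∀ {V : Type*} [Fintype V] [DecidableEq V] (D : Digraph V) (hD : Aromatic.IsAromatic D),
      Aromatic.coeff (Aromatic.compProd b a) (Aromatic.forestOf D hD) =
        ∑ R ∈ Aromatic.admissible D,
          Aromatic.coeff b (Aromatic.forestOf (Aromatic.induced D Rᶜ) (hD.induced Rᶜ)) *
          Aromatic.coeff a (Aromatic.forestOf (Aromatic.induced D R) (hD.induced R))) ∧
    (∀ {K : Type*} [RCLike K] {n : ℕ} {W : Type*} [NormedAddCommGroup W] [NormedSpace K W]
      [NormedSpace 𝕜 W] [SMulCommClass K 𝕜 W]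
      (f : (Fin n → K) → (Fin n → K)), ContDiff K ∞ f →
      ∀ G : ℕ → (Fin n → K) → W, (∀ m, ContDiff K ∞ (G m)) →
        Aromatic.sSeries f b (Aromatic.sSeries f a G) =
          Aromatic.sSeries f (Aromatic.compProd b a) G) := by
  refine ⟨fun {V} _ _ D hD => ?_, fun {K} _ {n W} _ _ _ _ f hf G hG => ?_⟩
  · rw [Aromatic.coeff_compProd, Aromatic.partitionSum]
    congr!
  · funext m
    unfold Aromatic.sSeries
    simp only [Aromatic.sSeriesPart_compProd hf a b _ (hG _)]
    have hsum := fun k l => Aromatic.sSeriesPart_sum (f := f) b k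
      (Finset.HasAntidiagonal.antidiagonal l) (G := fun kl => Aromatic.sSeriesPart f a kl.1 (G kl.2))
      fun kl _ => Aromatic.contDiff_sSeriesPart hf a _ (hG kl.2)
    simp only [hsum]
    rw [Finset.sum_sigma', Finset.sum_sigma']
    refine Finset.sum_nbij' (fun x => ⟨(x.1.1 + x.2.1, x.2.2), (x.1.1, x.2.1)⟩)
      (fun x => ⟨(x.2.1, x.2.2 + x.1.2), (x.2.2, x.1.2)⟩) ?_ ?_ ?_ ?_ fun _ _ => rfl
    all_goals
      rintro ⟨⟨k, l⟩, ⟨p, q⟩⟩ h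
      simp only [Finset.mem_sigma, Finset.HasAntidiagonal.mem_antidiagonal] at h ⊢
    · exact ⟨by omega, trivial⟩
    · exact ⟨by omega, trivial⟩
    · rw [h.2]
    · rw [h.2]
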